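/- (Zhan's conjecture for Heinz means.) Let $n$ be a natural number and let $A, B \in M_n(\mathbb{C})$ be (Hermitian) positive semidefinite matrices. For $0 \le s \le 1$ let $A^s$ denote the image of $A$ under the function $x \mapsto x^s$ on $[0,\infty)$ in the functional calculus, with the convention $x^0 = 1$, so that $A^0$ is the identity matrix. For $M \in M_n(\mathbb{C})$ let $\sigma_1(M) \ge \sigma_2(M) \ge \dots \ge \sigma_n(M) \ge 0$ denote the singular values of $M$, counted with multiplicity and sorted in non-increasing order. Then for every $0 \le s \le 1$ and every $j = 1, \dots, n$, $$\sigma_j\bigl(A^s B^{1-s} + A^{1-s} B^s\bigr) \le \sigma_j(A+B).$$ -/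

import Mathlib

open scoped ComplexOrder MatrixOrder

/-! For `s ≤ 1 / 2` the Heinz sum factors as `X G² Y` with `X = A ^ s`, `Y = B ^ s` and `G² = A ^ (1
- 2s) + B ^ (1 - 2s)`. Put `H² = X² + Y² = A ^ (2s) + B ^ (2s)`. The Bhatia-Kittaneh inequality
gives `2 σⱼ(X G² Y) ≤ λⱼ(G H² G) = λⱼ(H G² H)`. Audenaert's inequality
(`CFC.conj_sqrt_rpow_add_rpow_le`), which combines operator concavity of `x ^ r` with operator
convexity of `x ^ (1 + r)`, bounds one of these two products by `2 (A + B)`. Instead of sorted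
eigenvalues, the proof transports a subspace of dimension greater than `j` on which a quadratic form
is bounded below; min-max turns it into a singular value bound at the end. -/

section CStarAlgebra

open Set Real

variable {A : Type*} [CStarAlgebra A] [PartialOrder A] [StarOrderedRing A]

/-! ### Operator convexity of powers and Audenaert's inequality. -/

namespace CFC

lemma rpow_add_of_exponent_nonneg {a : A} (_ha : 0 ≤ a) {x y : ℝ} (hx : 0 ≤ x) (hy : 0 ≤ y) :
    a ^ (x + y) = a ^ x * a ^ y := by
  simp only [rpow_def]
  rw [← cfc_mul _ _ a]
  refine cfc_congr fun z _ ↦ ?_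
  exact NNReal.rpow_add_of_nonneg z hx hy

/-- Up to a positive factor the integrand is an affine function plus `t (t + x)⁻¹`, and the inverse
is operator convex. -/
lemma convexOn_cfc_rpowIntegrand₁₂ (p : ℝ) {t : ℝ} (ht : 0 < t) :
    ConvexOn ℝ (Ici (0 : A)) (cfc (rpowIntegrand₁₂ p t)) := by
  have heq : (Ici (0 : A)).EqOn (cfc (rpowIntegrand₁₂ p t))
      (fun x : A =>
        t ^ (p - 1) • (t⁻¹ • x + t • Ring.inverse (algebraMap ℝ A t + x) - algebraMap ℝ A 1)) := by
    intro x hx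
    have hx' : 0 ≤ x := hx
    have hspectrum : ∀ r ∈ spectrum ℝ x, t + r ≠ 0 := by grind
    have hg : ContinuousOn (fun z : ℝ => (t + z)⁻¹) (spectrum ℝ x) := by
      fun_prop (disch := grind -abstractProof)
    have hg' : ContinuousOn (fun z : ℝ => t * (t + z)⁻¹) (spectrum ℝ x) := hg.const_mul t
    have hl : ContinuousOn (fun z : ℝ => t⁻¹ * z) (spectrum ℝ x) := by fun_prop
    have h1 : ContinuousOn (fun _ : ℝ => (1 : ℝ)) (spectrum ℝ x) := continuousOn_const
    have hadd : ContinuousOn (fun z : ℝ => t⁻¹ * z + t * (t + z)⁻¹) (spectrum ℝ x) := hl.add hg'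
    have hsub : ContinuousOn (fun z : ℝ => t⁻¹ * z + t * (t + z)⁻¹ - 1) (spectrum ℝ x) :=
      hadd.sub h1
    unfold rpowIntegrand₁₂
    rw [cfc_const_mul _ _ x hsub, cfc_sub _ _ x hadd h1, cfc_add x _ _ hl hg',
      cfc_const_mul _ (fun z ↦ z) x continuousOn_id, cfc_const_mul _ _ x hg,
      cfc_inv _ _ hspectrum .., cfc_const_add .., cfc_id' .., cfc_const ..]
  refine ConvexOn.congr ?_ heq.symm
  refine ConvexOn.smul (by positivity) (ConvexOn.sub (ConvexOn.add ?_ ?_)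
    (concaveOn_const _ (convex_Ici 0)))
  · exact (convexOn_id (convex_Ici 0)).smul (by positivity)
  · exact ConvexOn.smul ht.le <| CStarAlgebra.convexOn_ringInverse_algebraMap_add ht

lemma convexOn_sq : ConvexOn ℝ (Ici (0 : A)) (fun a : A => a ^ 2) := by
  refine ⟨convex_Ici 0, fun x hx y hy a b ha hb hab ↦ ?_⟩
  have hx' : IsSelfAdjoint x := IsSelfAdjoint.of_nonneg hx
  have hy' : IsSelfAdjoint y := IsSelfAdjoint.of_nonneg hy
  have key : a • x ^ 2 + b • y ^ 2 - (a • x + b • y) ^ 2 = (a * b) • ((x - y) * (x - y)) := by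
    obtain rfl : b = 1 - a := by linarith
    simp only [sq, mul_add, add_mul, mul_sub, sub_mul, smul_mul_assoc, mul_smul_comm, smul_add,
      smul_sub]
    module
  rw [← sub_nonneg, key]
  exact smul_nonneg (mul_nonneg ha hb) (hx'.sub hy').mul_self_nonneg

/-- `a ↦ a ^ p` is operator convex for `p ∈ [1,2]`. -/
lemma convexOn_rpow_of_mem_Icc_one_two {p : ℝ} (hp : p ∈ Icc 1 2) :
    ConvexOn ℝ (Ici (0 : A)) (fun a : A => a ^ p) := by
  -- The integral representation covers only the open interval, so both endpoints are treated
  -- separately.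
  obtain rfl | h1 := eq_or_lt_of_le hp.1
  · exact (convexOn_id (convex_Ici 0)).congr fun a ha ↦ (rpow_one a ha).symm
  obtain rfl | h2 := eq_or_lt_of_le hp.2
  · exact convexOn_sq.congr fun a ha ↦ by simpa using (rpow_natCast a 2 ha).symm
  lift p to NNReal using (by linarith)
  have hq : p ∈ Ioo 1 2 := ⟨by exact_mod_cast h1, by exact_mod_cast h2⟩
  obtain ⟨μ, hμ⟩ := exists_measure_nnrpow_eq_integral_cfcₙ_rpowIntegrand₁₂ A hq
  have heq : (Ici 0).EqOn (fun a : A => a ^ (p : ℝ))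
      (fun a : A => ∫ t in Ioi 0, cfcₙ (rpowIntegrand₁₂ p t) a ∂μ) := fun a ha ↦ by
    simpa only [nnrpow_eq_rpow (zero_lt_one.trans hq.1)] using (hμ a ha).2
  refine ConvexOn.congr ?_ heq.symm
  refine MeasureTheory.integral_convexOn_of_integrand_ae (convex_Ici _) ?_ fun a ha => (hμ a ha).1
  filter_upwards [MeasureTheory.ae_restrict_mem measurableSet_Ioi] with t ht
  refine (convexOn_cfc_rpowIntegrand₁₂ p ht).congr fun a ha ↦ (cfcₙ_eq_cfc ?_ ?_).symm
  · refine ContinuousOn.mono (s := Ici 0) ?_ ?_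
    · exact (continuousOn_rpowIntegrand₁₂_uncurry h1 _ subset_rfl).uncurry_left _ ht
    · intro x hx
      have ha' : 0 ≤ a := ha
      grind
  · exact rpowIntegrand₁₂_zero ht

/-- With `m` the midpoint, concavity gives `(a ^ r + b ^ r) / 2 ≤ m ^ r`. Conjugation by `sqrt m`
turns the right side into `m ^ (1 + r)`, which convexity bounds by `(a ^ (1 + r) + b ^ (1 + r)) /
2`. -/
lemma conj_sqrt_midpoint_rpow_le {r : ℝ} (hr : r ∈ Icc 0 1) {a b : A} (ha : 0 ≤ a) (hb : 0 ≤ b) :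
    sqrt (midpoint ℝ a b) * (a ^ r + b ^ r) * sqrt (midpoint ℝ a b) ≤
      a ^ (1 + r) + b ^ (1 + r) := by
  set m := midpoint ℝ a b with hm
  have hm_eq : m = (1 / 2 : ℝ) • a + (1 / 2 : ℝ) • b := by
    rw [hm, midpoint_eq_smul_add, smul_add]; norm_num
  have hm0 : 0 ≤ m := by rw [hm_eq]; positivity
  have hconcave := (concaveOn_rpow (A := A) hr).2 (show a ∈ Ici 0 from ha) (show b ∈ Ici 0 from hb)
    (show (0 : ℝ) ≤ 1 / 2 by norm_num) (show (0 : ℝ) ≤ 1 / 2 by norm_num) (by norm_num)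
  have hconvex := (convexOn_rpow_of_mem_Icc_one_two (A := A) (p := 1 + r)
    ⟨by linarith [hr.1], by linarith [hr.2]⟩).2 (show a ∈ Ici 0 from ha) (show b ∈ Ici 0 from hb)
    (show (0 : ℝ) ≤ 1 / 2 by norm_num) (show (0 : ℝ) ≤ 1 / 2 by norm_num) (by norm_num)
  rw [← hm_eq, ← smul_add] at hconcave hconvex
  have hpow : sqrt m * m ^ r * sqrt m = m ^ (1 + r) := by
    have hr0 := hr.1
    rw [sqrt_eq_rpow, ← rpow_add_of_exponent_nonneg hm0 (by norm_num) hr0,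
      ← rpow_add_of_exponent_nonneg hm0 (by positivity) (by norm_num)]
    congr 1
    ring
  have hconj := conjugate_le_conjugate_of_nonneg hconcave (sqrt_nonneg m)
  rw [hpow, mul_smul_comm, smul_mul_assoc] at hconj
  exact le_of_smul_le_smul_left (hconj.trans hconvex) (by norm_num)

/-- Audenaert's inequality for the operator monotone function `x ↦ x ^ r`. -/
lemma conj_sqrt_add_rpow_le {r : ℝ} (hr : r ∈ Icc 0 1) {a b : A} (ha : 0 ≤ a) (hb : 0 ≤ b) :
    sqrt (a + b) * (a ^ r + b ^ r) * sqrt (a + b) ≤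
      (2 : ℝ) • (a ^ (1 + r) + b ^ (1 + r)) := by
  have hm : (2 : ℝ) • midpoint ℝ a b = a + b := by
    rw [midpoint_eq_smul_add, smul_smul]
    norm_num
  have hm0 : 0 ≤ midpoint ℝ a b := by
    rw [midpoint_eq_smul_add]
    exact smul_nonneg (by norm_num) (add_nonneg ha hb)
  have hsqrt : sqrt (a + b) = √(2 : ℝ) • sqrt (midpoint ℝ a b) := by
    refine sqrt_unique ?_ (smul_nonneg (Real.sqrt_nonneg 2) (sqrt_nonneg _))
    rw [smul_mul_smul_comm, Real.mul_self_sqrt zero_le_two, sqrt_mul_sqrt_self _ hm0, hm]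
  rw [hsqrt, smul_mul_assoc, smul_mul_smul_comm, Real.mul_self_sqrt zero_le_two]
  exact smul_le_smul_of_nonneg_left (conj_sqrt_midpoint_rpow_le hr ha hb) zero_le_two

/-- Audenaert's inequality for `a ^ t`, `b ^ t` and `r = (1 - t) / t`; `r ≤ 1` is exactly `t ≥ 1 /
2`. -/
lemma conj_sqrt_rpow_add_rpow_le {t : ℝ} (ht : t ∈ Icc (1 / 2) 1) {a b : A}
    (ha : 0 ≤ a) (hb : 0 ≤ b) :
    sqrt (a ^ t + b ^ t) * (a ^ (1 - t) + b ^ (1 - t)) * sqrt (a ^ t + b ^ t) ≤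
      (2 : ℝ) • (a + b) := by
  obtain ⟨ht1, ht2⟩ := ht
  have ht0 : 0 < t := by linarith
  have hr : (1 - t) / t ∈ Icc (0 : ℝ) 1 :=
    ⟨div_nonneg (by linarith) ht0.le, (div_le_one ht0).2 (by linarith)⟩
  have hpow {c : A} (hc : 0 ≤ c) : (c ^ t) ^ ((1 - t) / t) = c ^ (1 - t) := by
    rw [rpow_rpow_of_exponent_nonneg c _ _ ht0.le hr.1 hc, mul_div_cancel₀ _ ht0.ne']
  have hpow' {c : A} (hc : 0 ≤ c) : (c ^ t) ^ (1 + (1 - t) / t) = c := by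
    rw [rpow_rpow_of_exponent_nonneg c _ _ ht0.le (by linarith [hr.1]) hc]
    convert rpow_one c hc using 2
    field_simp
    ring
  have key := conj_sqrt_add_rpow_le hr (rpow_nonneg (a := a) (y := t)) (rpow_nonneg (a := b) (y := t))
  rwa [hpow ha, hpow hb, hpow' ha, hpow' hb] at key

lemma rpow_mul_add_rpow_mul_rpow {s : ℝ} (hs0 : 0 ≤ s) (hs : s ≤ 1 / 2) {a b : A}
    (ha : 0 ≤ a) (hb : 0 ≤ b) :
    a ^ s * (a ^ (1 - 2 * s) + b ^ (1 - 2 * s)) * b ^ s =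
      a ^ s * b ^ (1 - s) + a ^ (1 - s) * b ^ s := by
  have hs' : 0 ≤ 1 - 2 * s := by linarith
  rw [mul_add, add_mul, mul_assoc (a ^ s) (b ^ _), ← rpow_add_of_exponent_nonneg ha hs0 hs',
    ← rpow_add_of_exponent_nonneg hb hs' hs0, add_comm]
  ring_nf

end CFC

end CStarAlgebra

/-! ### Min-max for singular values and the Bhatia-Kittaneh inequality. -/

namespace LinearMap

open Module InnerProductSpace

variable {𝕜 : Type*} [RCLike 𝕜]
  {E : Type*} [NormedAddCommGroup E] [InnerProductSpace 𝕜 E] [FiniteDimensional 𝕜 E]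
  {F : Type*} [NormedAddCommGroup F] [InnerProductSpace 𝕜 F] [FiniteDimensional 𝕜 F]

lemma norm_apply_sq_eq_sum_singularValues (T : E →ₗ[𝕜] F) (x : E) :
    ‖T x‖ ^ 2 = ∑ i : Fin (finrank 𝕜 E), T.singularValues i ^ 2 *
      ‖(T.isSymmetric_adjoint_comp_self.eigenvectorBasis rfl).repr x i‖ ^ 2 := by
  set b := T.isSymmetric_adjoint_comp_self.eigenvectorBasis rfl with hb
  have h1 : ‖T x‖ ^ 2 = RCLike.re ⟪x, (adjoint T ∘ₗ T) x⟫_𝕜 := by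
    rw [comp_apply, adjoint_inner_right, inner_self_eq_norm_sq]
  rw [h1, ← b.repr.inner_map_map, PiLp.inner_apply, map_sum]
  refine Finset.sum_congr rfl fun i _ ↦ ?_
  rw [hb, T.isSymmetric_adjoint_comp_self.eigenvectorBasis_apply_self_apply,
    T.sq_singularValues_fin rfl, RCLike.inner_apply, mul_assoc, RCLike.mul_conj, RCLike.re_ofReal_mul]
  norm_cast

/-- One half of the min-max principle for singular values. -/
lemma le_singularValues_of_forall_mem (T : E →ₗ[𝕜] F) {j : ℕ} {c : ℝ} (V : Submodule 𝕜 E)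
    (hV : j < finrank 𝕜 V) (h : ∀ x ∈ V, c * ‖x‖ ≤ ‖T x‖) : c ≤ T.singularValues j := by
  have hj : j < finrank 𝕜 E := hV.trans_le V.finrank_le
  set b := T.isSymmetric_adjoint_comp_self.eigenvectorBasis rfl with hb
  -- Only `j` coordinates are killed, so `V`, of dimension greater than `j`, contains a nonzero
  -- vector orthogonal to the first `j` eigenvectors.
  let coords : V →ₗ[𝕜] (Fin j → 𝕜) := LinearMap.pi fun i ↦
    (b.toBasis.coord (Fin.castLE hj.le i)) ∘ₗ V.subtype
  obtain ⟨x, hx, hx0⟩ := (coords.ker.ne_bot_iff).1 (ker_ne_bot_of_finrank_lt (by simpa using hV))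
  have hcoord : ∀ i : Fin (finrank 𝕜 E), (i : ℕ) < j → b.repr x i = 0 := fun i hi ↦ by
    simpa [coords] using congr_fun (mem_ker.1 hx) ⟨i, hi⟩
  have hle : ‖T x‖ ≤ T.singularValues j * ‖(x : E)‖ := by
    refine (sq_le_sq₀ (norm_nonneg _)
      (mul_nonneg (T.singularValues_nonneg j) (norm_nonneg _))).1 ?_
    rw [norm_apply_sq_eq_sum_singularValues, mul_pow, ← b.repr.norm_map (x : E),
      EuclideanSpace.norm_sq_eq, Finset.mul_sum]
    refine Finset.sum_le_sum fun i _ ↦ ?_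
    rcases lt_or_ge (i : ℕ) j with hi | hi
    · simp [← hb, hcoord i hi]
    · have := T.singularValues_antitone hi
      have := T.singularValues_nonneg i
      gcongr
  refine le_of_mul_le_mul_right ((h x x.2).trans hle) (norm_pos_iff.2 ?_)
  simpa using hx0

/-- The other half of the min-max principle for singular values. -/
lemma exists_forall_mem_singularValues_mul_norm_le (T : E →ₗ[𝕜] F) {j : ℕ}
    (hj : j < finrank 𝕜 E) :
    ∃ V : Submodule 𝕜 E, j < finrank 𝕜 V ∧ ∀ x ∈ V, T.singularValues j * ‖x‖ ≤ ‖T x‖ := by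
  set b := T.isSymmetric_adjoint_comp_self.eigenvectorBasis rfl with hb
  let v : Fin (j + 1) → E := fun i ↦ b (Fin.castLE hj i)
  refine ⟨Submodule.span 𝕜 (Set.range v), ?_, fun x hx ↦ ?_⟩
  · rw [finrank_span_eq_card]
    · simp
    · exact b.orthonormal.linearIndependent.comp _ (Fin.castLE_injective hj)
  have hcoord : ∀ i : Fin (finrank 𝕜 E), j < i → b.repr x i = 0 := fun i hi ↦ by
    have : Submodule.span 𝕜 (Set.range v) ≤ ker (b.toBasis.coord i) := by
      rw [Submodule.span_le]
      rintro _ ⟨k, rfl⟩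
      have : Fin.castLE hj k ≠ i := fun h ↦ by
        have := congr_arg Fin.val h
        simp at this
        omega
      simp [v, this]
    simpa using this hx
  refine (sq_le_sq₀ (mul_nonneg (T.singularValues_nonneg j) (norm_nonneg _)) (norm_nonneg _)).1 ?_
  rw [norm_apply_sq_eq_sum_singularValues, mul_pow, ← b.repr.norm_map x,
    EuclideanSpace.norm_sq_eq, Finset.mul_sum]
  refine Finset.sum_le_sum fun i _ ↦ ?_
  rcases lt_or_ge j (i : ℕ) with hi | hi
  · simp [← hb, hcoord i hi]
  · have := T.singularValues_antitone hi
    have := T.singularValues_nonneg j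
    gcongr

/-- A lower bound for the quadratic form of `T† T` on a subspace passes to `T T†`. -/
lemma exists_forall_mem_adjoint_norm_sq_ge (T : E →ₗ[𝕜] F) {j : ℕ} {c : ℝ} (hc : 0 < c)
    (V : Submodule 𝕜 E) (hV : j < finrank 𝕜 V) (h : ∀ x ∈ V, c * ‖x‖ ^ 2 ≤ ‖T x‖ ^ 2) :
    ∃ W : Submodule 𝕜 F, j < finrank 𝕜 W ∧ ∀ y ∈ W, c * ‖y‖ ^ 2 ≤ ‖adjoint T y‖ ^ 2 := by
  -- The bound makes `T` injective on `V`; on the image it follows from `‖T x‖² ≤ ‖T† T x‖ ‖x‖`.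
  refine ⟨V.map T, ?_, ?_⟩
  · rw [← range_domRestrict, finrank_range_of_inj]
    · exact hV
    · rw [injective_iff_map_eq_zero]
      rintro ⟨x, hx⟩ hx0
      have h1 := h x hx
      have h2 : T x = 0 := hx0
      rw [h2, norm_zero] at h1
      have : ‖x‖ ^ 2 ≤ 0 := by nlinarith
      simpa using this
  · rintro _ ⟨x, hx, rfl⟩
    have h1 := h x hx
    have h2 : ‖T x‖ ^ 2 ≤ ‖adjoint T (T x)‖ * ‖x‖ := by
      rw [← inner_self_eq_norm_sq (𝕜 := 𝕜), ← adjoint_inner_left]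
      exact re_inner_le_norm _ _
    rcases eq_or_ne (T x) 0 with h0 | h0
    · simp [h0]
    have hpos : 0 < ‖T x‖ ^ 2 := by positivity
    have h3 : (‖T x‖ ^ 2) ^ 2 ≤ ‖adjoint T (T x)‖ ^ 2 * ‖x‖ ^ 2 := by
      rw [← mul_pow]; gcongr
    refine le_of_mul_le_mul_right ?_ hpos
    calc c * ‖T x‖ ^ 2 * ‖T x‖ ^ 2 = c * (‖T x‖ ^ 2) ^ 2 := by ring
      _ ≤ c * (‖adjoint T (T x)‖ ^ 2 * ‖x‖ ^ 2) := by gcongr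
      _ = ‖adjoint T (T x)‖ ^ 2 * (c * ‖x‖ ^ 2) := by ring
      _ ≤ ‖adjoint T (T x)‖ ^ 2 * ‖T x‖ ^ 2 := by gcongr

/-- The arithmetic-geometric mean inequality of Bhatia and Kittaneh, in variational form:
`2 σⱼ(C† D) ≤ λⱼ(C C† + D D†)`. -/
lemma exists_forall_mem_two_mul_singularValues_le (C D : E →ₗ[𝕜] F) {j : ℕ}
    (hpos : 0 < (adjoint C ∘ₗ D).singularValues j) :
    ∃ W : Submodule 𝕜 F, j < finrank 𝕜 W ∧ ∀ y ∈ W,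
      2 * (adjoint C ∘ₗ D).singularValues j * ‖y‖ ^ 2 ≤
        ‖adjoint C y‖ ^ 2 + ‖adjoint D y‖ ^ 2 := by
  set K := adjoint C ∘ₗ D with hK
  set τ := K.singularValues j with hτ
  have hj : j < finrank 𝕜 E := by
    by_contra! hj
    exact hpos.ne' (K.singularValues_of_finrank_le hj)
  obtain ⟨V, hV, hVle⟩ := K.exists_forall_mem_singularValues_mul_norm_le hj
  -- `S w` is the row operator `(C D)` applied to `(K w, τ w)`, and `(C D)(C D)† = C C† + D D†`.
  let S : E →ₗ[𝕜] F := C ∘ₗ K + (τ : 𝕜) • D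
  have hSapply (w : E) : S w = C (K w) + (τ : 𝕜) • D w := rfl
  have hinner (w : E) : RCLike.re ⟪C (K w), (τ : 𝕜) • D w⟫_𝕜 = τ * ‖K w‖ ^ 2 := by
    rw [inner_smul_right, RCLike.re_ofReal_mul, ← adjoint_inner_right,
      show adjoint C (D w) = K w from rfl, inner_self_eq_norm_sq]
  -- Polarization: `4 Re⟪u, v⟫ = ‖u + v‖² - ‖u - v‖²`.
  have hS (w : E) : 4 * (τ * ‖K w‖ ^ 2) ≤ ‖S w‖ ^ 2 := by
    have h1 := norm_add_sq (𝕜 := 𝕜) (C (K w)) ((τ : 𝕜) • D w)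
    have h2 := norm_sub_sq (𝕜 := 𝕜) (C (K w)) ((τ : 𝕜) • D w)
    rw [hinner] at h1 h2
    rw [hSapply]
    nlinarith [sq_nonneg ‖C (K w) - (τ : 𝕜) • D w‖]
  have hSV (w : E) (hw : w ∈ V) : 2 * τ * (‖K w‖ ^ 2 + (τ * ‖w‖) ^ 2) ≤ ‖S w‖ ^ 2 := by
    have h1 : (τ * ‖w‖) ^ 2 ≤ ‖K w‖ ^ 2 := by
      have := hVle w hw
      gcongr
    nlinarith [hS w]
  refine ⟨V.map S, ?_, ?_⟩
  · rw [← range_domRestrict, finrank_range_of_inj]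
    · exact hV
    · rw [injective_iff_map_eq_zero]
      rintro ⟨w, hw⟩ hw0
      have h1 := hSV w hw
      have h2 : S w = 0 := hw0
      rw [h2, norm_zero] at h1
      have h3 : (τ * ‖w‖) ^ 2 ≤ 0 := by nlinarith [sq_nonneg ‖K w‖, sq_nonneg (τ * ‖w‖)]
      simpa [hpos.ne'] using h3
  · rintro _ ⟨w, hw, rfl⟩
    have h1 := hSV w hw
    set y := S w with hy
    have h2 : ‖y‖ ^ 2 ≤ ‖adjoint C y‖ * ‖K w‖ + ‖adjoint D y‖ * (τ * ‖w‖) := by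
      calc ‖y‖ ^ 2 = RCLike.re ⟪y, C (K w) + (τ : 𝕜) • D w⟫_𝕜 := by
            rw [← hSapply, ← hy, inner_self_eq_norm_sq]
        _ = RCLike.re ⟪adjoint C y, K w⟫_𝕜 + τ * RCLike.re ⟪adjoint D y, w⟫_𝕜 := by
            rw [inner_add_right, inner_smul_right, map_add, RCLike.re_ofReal_mul,
              adjoint_inner_left, adjoint_inner_left]
        _ ≤ ‖adjoint C y‖ * ‖K w‖ + τ * (‖adjoint D y‖ * ‖w‖) := by
            gcongr <;> exact re_inner_le_norm _ _
        _ = _ := by ring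
    set N := ‖adjoint C y‖ ^ 2 + ‖adjoint D y‖ ^ 2 with hN
    set M := ‖K w‖ ^ 2 + (τ * ‖w‖) ^ 2 with hM
    -- Cauchy-Schwarz in the plane; the squared term is the Lagrange identity remainder.
    have h3 : (‖y‖ ^ 2) ^ 2 ≤ N * M := by
      calc (‖y‖ ^ 2) ^ 2 ≤ (‖adjoint C y‖ * ‖K w‖ + ‖adjoint D y‖ * (τ * ‖w‖)) ^ 2 := by gcongr
        _ ≤ N * M := by
            rw [hN, hM]
            nlinarith [sq_nonneg (‖adjoint C y‖ * (τ * ‖w‖) - ‖adjoint D y‖ * ‖K w‖)]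
    rcases eq_or_ne y 0 with h0 | h0
    · simp [h0, hN]
    have hy0 : 0 < ‖y‖ ^ 2 := by positivity
    refine le_of_mul_le_mul_right ?_ hy0
    calc 2 * τ * ‖y‖ ^ 2 * ‖y‖ ^ 2 = 2 * τ * (‖y‖ ^ 2) ^ 2 := by ring
      _ ≤ 2 * τ * (N * M) := by gcongr
      _ = N * (2 * τ * M) := by ring
      _ ≤ N * ‖y‖ ^ 2 := by gcongr

end LinearMap

/-! ### Transfer to matrices and conclusion. -/

namespace Matrix

variable {𝕜 : Type*} [RCLike 𝕜] {n : Type*} [Fintype n] [DecidableEq n]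

lemma toEuclideanLin_mul (M N : Matrix n n 𝕜) :
    toEuclideanLin (M * N) = toEuclideanLin M ∘ₗ toEuclideanLin N := by
  ext x : 1
  simp [toLpLin_apply]

lemma re_inner_toEuclideanLin_mono {M N : Matrix n n 𝕜} (h : M ≤ N) (x : EuclideanSpace 𝕜 n) :
    RCLike.re (inner 𝕜 (toEuclideanLin M x) x) ≤ RCLike.re (inner 𝕜 (toEuclideanLin N x) x) := by
  have := (isPositive_toEuclideanLin_iff.2 (le_iff.1 h)).2 x
  rw [map_sub, LinearMap.sub_apply, inner_sub_left, map_sub] at this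
  exact sub_nonneg.1 this

lemma norm_toEuclideanLin_sq (M : Matrix n n 𝕜) (x : EuclideanSpace 𝕜 n) :
    ‖toEuclideanLin M x‖ ^ 2 = RCLike.re (inner 𝕜 (toEuclideanLin (Mᴴ * M) x) x) := by
  rw [toEuclideanLin_mul, toEuclideanLin_conjTranspose_eq_adjoint, LinearMap.comp_apply,
    LinearMap.adjoint_inner_left, inner_self_eq_norm_sq]

/-- On `W`, `2c ‖x‖² ≤ ⟪M† M x, x⟫ ≤ 2 Re⟪N x, x⟫ ≤ 2 ‖N x‖ ‖x‖`, so min-max applies to `N`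
directly. -/
lemma le_singularValues_of_conj_le {M N : Matrix n n 𝕜} {j : ℕ} {c : ℝ}
    (h : Mᴴ * M ≤ (2 : ℝ) • N) (W : Submodule 𝕜 (EuclideanSpace 𝕜 n))
    (hW : j < Module.finrank 𝕜 W)
    (hM : ∀ x ∈ W, 2 * c * ‖x‖ ^ 2 ≤ ‖toEuclideanLin M x‖ ^ 2) :
    c ≤ (toEuclideanLin N).singularValues j := by
  refine LinearMap.le_singularValues_of_forall_mem _ W hW fun x hx ↦ ?_
  rcases eq_or_ne x 0 with rfl | h0
  · simp
  have h1 := re_inner_toEuclideanLin_mono h x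
  have h2 : toEuclideanLin ((2 : ℝ) • N) x = (2 : 𝕜) • toEuclideanLin N x := by
    rw [two_smul, map_add, LinearMap.add_apply, two_smul]
  have h3 : RCLike.re (inner 𝕜 (toEuclideanLin N x) x) ≤ ‖toEuclideanLin N x‖ * ‖x‖ :=
    re_inner_le_norm _ _
  have h4 := hM x hx
  rw [norm_toEuclideanLin_sq] at h4
  rw [h2, two_smul, inner_add_left, map_add] at h1
  refine le_of_mul_le_mul_right ?_ (norm_pos_iff.2 h0)
  linarith

/-- If `X² + Y² = H²` then `2 σⱼ(X G² Y) ≤ λⱼ(G H² G)`, in variational form. -/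
lemma exists_forall_mem_two_mul_singularValues_le {G H X Y : Matrix n n 𝕜} (hG : G.IsHermitian)
    (hH : H.IsHermitian) (hX : X.IsHermitian) (hY : Y.IsHermitian) (hXY : X * X + Y * Y = H * H)
    {j : ℕ} (hpos : 0 < (toEuclideanLin (X * (G * G) * Y)).singularValues j) :
    ∃ W : Submodule 𝕜 (EuclideanSpace 𝕜 n), j < Module.finrank 𝕜 W ∧ ∀ x ∈ W,
      2 * (toEuclideanLin (X * (G * G) * Y)).singularValues j * ‖x‖ ^ 2 ≤
        ‖toEuclideanLin (H * G) x‖ ^ 2 := by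
  have hadj {Z : Matrix n n 𝕜} (hZ : Z.IsHermitian) :
      LinearMap.adjoint (toEuclideanLin (G * Z)) = toEuclideanLin (Z * G) := by
    rw [← toEuclideanLin_conjTranspose_eq_adjoint, conjTranspose_mul, hG.eq, hZ.eq]
  -- Take `C = G X` and `D = G Y`, so that `C C† + D D† = G (X² + Y²) G`.
  have hK : toEuclideanLin (X * (G * G) * Y) =
      LinearMap.adjoint (toEuclideanLin (G * X)) ∘ₗ toEuclideanLin (G * Y) := by
    rw [hadj hX, ← toEuclideanLin_mul]
    simp only [mul_assoc]
  rw [hK] at hpos ⊢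
  obtain ⟨W, hW, h⟩ := LinearMap.exists_forall_mem_two_mul_singularValues_le _ _ hpos
  refine ⟨W, hW, fun x hx ↦ (h x hx).trans_eq ?_⟩
  have hconj {Z : Matrix n n 𝕜} (hZ : Z.IsHermitian) : (Z * G)ᴴ * (Z * G) = G * (Z * Z) * G := by
    rw [conjTranspose_mul, hG.eq, hZ.eq]
    simp only [mul_assoc]
  rw [hadj hX, hadj hY, norm_toEuclideanLin_sq, norm_toEuclideanLin_sq, norm_toEuclideanLin_sq,
    hconj hX, hconj hY, hconj hH, ← hXY, mul_add, add_mul, map_add, LinearMap.add_apply,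
    inner_add_left, map_add]

/-- The two products in `h` are `T† T` and `T T†` for `T = H G`, so a bound on either one suffices.
-/
lemma singularValues_le_of_conj_le {G H X Y N : Matrix n n 𝕜} (hG : G.IsHermitian)
    (hH : H.IsHermitian) (hX : X.IsHermitian) (hY : Y.IsHermitian) (hXY : X * X + Y * Y = H * H)
    (h : G * (H * H) * G ≤ (2 : ℝ) • N ∨ H * (G * G) * H ≤ (2 : ℝ) • N) (j : ℕ) :
    (toEuclideanLin (X * (G * G) * Y)).singularValues j ≤
      (toEuclideanLin N).singularValues j := by
  rcases (LinearMap.singularValues_nonneg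
    (toEuclideanLin (X * (G * G) * Y)) j).eq_or_lt with h0 | hpos
  · exact h0 ▸ LinearMap.singularValues_nonneg _ j
  obtain ⟨W, hW, hle⟩ := exists_forall_mem_two_mul_singularValues_le hG hH hX hY hXY hpos
  rcases h with h | h
  · refine le_singularValues_of_conj_le (M := H * G) ?_ W hW hle
    rwa [conjTranspose_mul, hG.eq, hH.eq, mul_assoc, ← mul_assoc H H G, ← mul_assoc G]
  · obtain ⟨W', hW', hle'⟩ :=
      LinearMap.exists_forall_mem_adjoint_norm_sq_ge _ (by positivity) W hW hle
    rw [← toEuclideanLin_conjTranspose_eq_adjoint, conjTranspose_mul, hG.eq, hH.eq] at hle'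
    refine le_singularValues_of_conj_le (M := G * H) ?_ W' hW' hle'
    rwa [conjTranspose_mul, hG.eq, hH.eq, mul_assoc, ← mul_assoc G G H, ← mul_assoc H]

open scoped Matrix.Norms.L2Operator in
/-- Zhan's conjecture for `s ≤ 1 / 2`. -/
lemma singularValues_heinz_le_of_le_half {A B : Matrix n n ℂ} (hA : A.PosSemidef)
    (hB : B.PosSemidef) {s : ℝ} (hs0 : 0 ≤ s) (hs : s ≤ 1 / 2) (j : ℕ) :
    (toEuclideanLin (A ^ s * B ^ (1 - s) + A ^ (1 - s) * B ^ s)).singularValues j ≤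
      (toEuclideanLin (A + B)).singularValues j := by
  have hA' : 0 ≤ A := nonneg_iff_posSemidef.2 hA
  have hB' : 0 ≤ B := nonneg_iff_posSemidef.2 hB
  have hherm {M : Matrix n n ℂ} (hM : 0 ≤ M) : M.IsHermitian := (nonneg_iff_posSemidef.1 hM).1
  have hsqrt (t : ℝ) : CFC.sqrt (A ^ t + B ^ t) * CFC.sqrt (A ^ t + B ^ t) = A ^ t + B ^ t :=
    CFC.sqrt_mul_sqrt_self _ (add_nonneg CFC.rpow_nonneg CFC.rpow_nonneg)
  have hdouble {M : Matrix n n ℂ} (hM : 0 ≤ M) : M ^ s * M ^ s = M ^ (2 * s) := by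
    rw [← CFC.rpow_add_of_exponent_nonneg hM hs0 hs0, two_mul]
  rw [← CFC.rpow_mul_add_rpow_mul_rpow hs0 hs hA' hB', ← hsqrt (1 - 2 * s)]
  refine singularValues_le_of_conj_le (H := CFC.sqrt (A ^ (2 * s) + B ^ (2 * s)))
    (hherm (CFC.sqrt_nonneg _)) (hherm (CFC.sqrt_nonneg _)) (hherm CFC.rpow_nonneg)
    (hherm CFC.rpow_nonneg) ?_ ?_ j
  · rw [hdouble hA', hdouble hB', hsqrt]
  · rw [hsqrt, hsqrt]
    -- Audenaert's inequality needs the outer exponent to be at least `1 / 2`: this is `1 - 2s` for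
    -- `s ≤ 1 / 4`, and `2s` otherwise.
    rcases le_total s (1 / 4) with h | h
    · left
      have := CFC.conj_sqrt_rpow_add_rpow_le (t := 1 - 2 * s) ⟨by linarith, by linarith⟩ hA' hB'
      rwa [sub_sub_cancel] at this
    · right
      exact CFC.conj_sqrt_rpow_add_rpow_le (t := 2 * s) ⟨by linarith, by linarith⟩ hA' hB'

end Matrix

/-- Here `A ^ s` is the matrix power `x ↦ x ^ s` of the functional calculus (with `A ^ 0 = 1`), and
`(Matrix.toEuclideanLin M).singularValues` lists the singular values of `M` in non-increasing order,
indexed from zero. -/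
theorem theorem2 (n : ℕ) (A B : Matrix (Fin n) (Fin n) ℂ)
    (hA : A.PosSemidef) (hB : B.PosSemidef) (s : ℝ) (hs0 : 0 ≤ s) (hs1 : s ≤ 1) (j : Fin n) :
    (Matrix.toEuclideanLin (A ^ s * B ^ (1 - s) + A ^ (1 - s) * B ^ s)).singularValues j ≤
      (Matrix.toEuclideanLin (A + B)).singularValues j := by
  rcases le_total s (1 / 2) with hs | hs
  · exact Matrix.singularValues_heinz_le_of_le_half hA hB hs0 hs j
  -- Replacing `s` by `1 - s` only swaps the two summands.
  · have key := Matrix.singularValues_heinz_le_of_le_half hA hB (s := 1 - s) (by linarith)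
      (by linarith) j
    rwa [sub_sub_cancel, add_comm] at key
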